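/- Let $T>0$, $\kappa>0$, $\rho\in\mathbb{R}$, and let $W^S=(W^S_t)_{t\in[0,T]}$ and $W^r=(W^r_t)_{t\in[0,T]}$ be standard Wiener processes with respect to a common filtration on a probability space, with $d\langle W^S,W^r\rangle_t=\rho\,dt$ (so that necessarily $|\rho|\le 1$). Let $R=(R_t)_{t\in[0,T]}$ be the continuous adapted solution of $$dR_t=-\kappa R_t\,dt+dW^r_t,\qquad R_0=0 .$$ Then for all $t\ge 0$ and $\Delta t>0$ with $t+\Delta t\le T$, the regular conditional distribution of $W^S_{t+\Delta t}-W^S_t$ given $(R_{t+\Delta t},R_t)$ is, almost surely, the Gaussian distribution $\mathcal N(\mu_{W\mid R},\sigma^2_{W\mid R})$ with $$\mu_{W\mid R}=2\rho\,\frac{1-e^{-\kappa\Delta t}}{1-e^{-2\kappa\Delta t}}\left(R_{t+\Delta t}-R_t e^{-\kappa\Delta t}\right),\qquad \sigma^2_{W\mid R}=\Delta t-2\,\frac{\rho^2}{\kappa}\,\frac{1-e^{-\kappa\Delta t}}{1+e^{-\kappa\Delta t}} ,$$ where in particular $\sigma^2_{W\mid R}\ge 0$. -/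

import Mathlib

open MeasureTheory ProbabilityTheory

/-- `W` is a standard Wiener process on the time interval `[0, T]` relative to the filtration `F`:
it is adapted, starts at `0`, the increment `W t - W s` is centred Gaussian with variance `t - s`
and independent of `F s` for `s ≤ t`, and almost all paths are continuous. -/
structure IsWienerProcess {Ω : Type*} {mΩ : MeasurableSpace Ω} {T : ℝ}
    (F : Filtration (Set.Icc (0 : ℝ) T) mΩ) (W : Set.Icc (0 : ℝ) T → Ω → ℝ)
    (P : Measure Ω) : Prop where
  adapted : Adapted F W
  zero : ∀ t : Set.Icc (0 : ℝ) T, (t : ℝ) = 0 → ∀ᵐ ω ∂P, W t ω = 0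
  increment_law : ∀ s t : Set.Icc (0 : ℝ) T, s ≤ t →
    HasLaw (fun ω => W t ω - W s ω) (gaussianReal 0 (Real.toNNReal ((t : ℝ) - (s : ℝ)))) P
  increment_indep : ∀ s t : Set.Icc (0 : ℝ) T, s ≤ t →
    Indep (MeasurableSpace.comap (fun ω => W t ω - W s ω) inferInstance) (F s) P
  continuous_paths : ∀ᵐ ω ∂P, Continuous (fun t => W t ω)

/-- `A` is the cross-variation (bracket) `⟨M, N⟩` of two continuous square-integrable
`F`-martingales `M`, `N` on `[0, T]`: the (up to indistinguishability unique) adapted process with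
continuous paths of bounded variation and `A 0 = 0` such that `M N - A` is an `F`-martingale. -/
structure IsCrossVariation {Ω : Type*} {mΩ : MeasurableSpace Ω} {T : ℝ}
    (F : Filtration (Set.Icc (0 : ℝ) T) mΩ) (M N A : Set.Icc (0 : ℝ) T → Ω → ℝ)
    (P : Measure Ω) : Prop where
  adapted : Adapted F A
  zero : ∀ t : Set.Icc (0 : ℝ) T, (t : ℝ) = 0 → ∀ᵐ ω ∂P, A t ω = 0
  continuous_paths : ∀ᵐ ω ∂P, Continuous (fun t => A t ω)
  boundedVariation_paths : ∀ᵐ ω ∂P, BoundedVariationOn (fun t => A t ω) Set.univ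
  martingale : Martingale (fun t ω => M t ω * N t ω - A t ω) F P

/-- `R` solves `dR_t = -κ R_t dt + dW_t`, `R_0 = 0` on `[0, T]`: it is adapted, has almost surely
continuous paths, and almost surely `R_t = -κ ∫_0^t R_s ds + W_t` for all `t ∈ [0, T]`.
The integral is with respect to Lebesgue measure on the interval `[0, T]`, over the times
`s ≤ t`. -/
structure IsVasicekSolution {Ω : Type*} {mΩ : MeasurableSpace Ω} {T : ℝ}
    (F : Filtration (Set.Icc (0 : ℝ) T) mΩ) (κ : ℝ) (W R : Set.Icc (0 : ℝ) T → Ω → ℝ)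
    (P : Measure Ω) : Prop where
  adapted : Adapted F R
  continuous_paths : ∀ᵐ ω ∂P, Continuous (fun t => R t ω)
  zero : ∀ t : Set.Icc (0 : ℝ) T, (t : ℝ) = 0 → ∀ᵐ ω ∂P, R t ω = 0
  integral_eq : ∀ᵐ ω ∂P, ∀ t : Set.Icc (0 : ℝ) T,
    R t ω = -κ * (∫ s in Set.Iic t, R s ω ∂(Measure.comap Subtype.val volume)) + W t ω

/-!
The conditional law is read off from characteristic functions; no stochastic integral and no
Lévy characterization is needed, because the two driving processes are Wiener processes with
known marginals and only their joint law has to be found.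

Put `N t = exp (κ t) R t`, which formally satisfies `dN = exp (κ t) dW^r`. Pathwise integration of
the equation for `R` gives
`N v - N u = exp (κ u) (W^r v - W^r u) + κ ∫ s in u..v, exp (κ s) (W^r v - W^r s)`,
and the last term is of order `(v - u) ^ (3 / 2)` in `L¹`
(`IsVasicekSolution.integral_abs_exp_mul_increment_sub_le`). For `Z` bounded and
`F t₀`-measurable let
`φ s = E[exp (i (a (W^S s - W^S t₀) + b (N s - N t₀))) Z]`. Over a short interval `[u, v]` the
exponential is expanded to second order. First moments vanish by independence of the increments
from `F u`, second moments are `v - u`, and the mixed second moment is `ρ (v - u)` by the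
martingale property that defines the bracket (`integral_increment_mul_increment_smul`). The
remainder is controlled by the third absolute moments of the Gaussian increments, so it is again of
order `(v - u) ^ (3 / 2)` (`norm_integral_cexp_sub_one_mul_add_le`). Hence `φ' = -q φ` with
`q s = (a² + 2 a b ρ exp (κ s) + b² exp (2 κ s)) / 2`, which determines `φ`
(`eq_exp_smul_of_norm_sub_add_smul_le`, `integral_cexp_increments_mul`): conditionally on `F t₀`,
the pair `(W^S t₁ - W^S t₀, N t₁ - N t₀)` is a centred Gaussian vector with a deterministic
covariance matrix.

Taking `Z` a character of `R t₀` and subtracting from `W^S t₁ - W^S t₀` its regression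
`β (N t₁ - N t₀)` leaves a centred Gaussian variable independent of `(R t₁, R t₀)`, with variance
the `σ²` of the statement (`map_prodMk_eq_prod_gaussianReal`). Adding the regression back gives the
conditional distribution (`condDistrib_add_ae_eq_gaussianReal`).
-/

/-! ### Taylor bounds for characters of the real line -/

lemma norm_cexp_mul_I_sub_taylor_two_le (x : ℝ) :
    ‖Complex.exp (x * Complex.I) - 1 - x * Complex.I + (x : ℂ) ^ 2 / 2‖ ≤ 4 * |x| ^ 3 := by
  rcases le_total |x| 1 with hx | hx
  · have h := Complex.exp_bound (x := x * Complex.I) (by simpa using hx) (n := 3) (by norm_num)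
    simp only [Finset.sum_range_succ, Finset.sum_range_zero, Nat.factorial, mul_pow,
      Complex.I_sq, norm_mul, Complex.norm_real, Complex.norm_I, mul_one] at h
    norm_num at h
    calc _ = ‖Complex.exp (x * Complex.I) - (1 + x * Complex.I + -(x : ℂ) ^ 2 / 2)‖ := by
          congr 1; ring
      _ ≤ _ := h
      _ ≤ _ := by nlinarith [pow_nonneg (abs_nonneg x) 3]
  · calc _ ≤ ‖Complex.exp (x * Complex.I)‖ + ‖(1 : ℂ)‖ + ‖x * Complex.I‖ + ‖(x : ℂ) ^ 2 / 2‖ :=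
          (norm_add_le _ _).trans (by
            gcongr; exact (norm_sub_le _ _).trans (by gcongr; exact norm_sub_le _ _))
      _ = 2 + |x| + |x| ^ 2 / 2 := by
          rw [Complex.norm_exp_ofReal_mul_I]; simp; ring
      _ ≤ _ := by nlinarith [mul_nonneg (abs_nonneg x) (sub_nonneg.2 hx), pow_two_nonneg (|x|),
          mul_nonneg (mul_nonneg (abs_nonneg x) (abs_nonneg x)) (sub_nonneg.2 hx)]

lemma norm_cexp_mul_I_sub_cexp_mul_I_le (x y : ℝ) :
    ‖Complex.exp (x * Complex.I) - Complex.exp (y * Complex.I)‖ ≤ |x - y| := by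
  have h : Complex.exp (x * Complex.I) - Complex.exp (y * Complex.I)
      = Complex.exp (y * Complex.I) * (Complex.exp (Complex.I * ((x - y : ℝ) : ℂ)) - 1) := by
    rw [mul_sub, ← Complex.exp_add]; push_cast; ring_nf
  rw [h, norm_mul, Complex.norm_exp_ofReal_mul_I, one_mul]
  exact Real.norm_exp_I_mul_ofReal_sub_one_le

/-! ### Absolute moments of Gaussian variables -/

/-- The absolute moment of order `n` of the standard Gaussian distribution. -/
noncomputable def gaussianAbsMoment (n : ℕ) : ℝ := ∫ x, |x| ^ n ∂(gaussianReal 0 1)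

lemma gaussianAbsMoment_nonneg (n : ℕ) : 0 ≤ gaussianAbsMoment n :=
  integral_nonneg fun _ => by positivity

section Gaussian

variable {Ω : Type*} {mΩ : MeasurableSpace Ω} {P : Measure Ω} {X : Ω → ℝ} {v : NNReal}

lemma ProbabilityTheory.HasLaw.integrable_abs_pow_gaussianReal
    (hX : HasLaw X (gaussianReal 0 v) P) (n : ℕ) : Integrable (fun ω => |X ω| ^ n) P := by
  have h : Integrable (fun x : ℝ => |x| ^ n) (gaussianReal 0 v) := by
    simpa using (memLp_id_gaussianReal (μ := 0) (v := v) n).integrable_norm_pow'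
  rw [← hX.map_eq] at h
  exact h.comp_aemeasurable hX.aemeasurable

lemma ProbabilityTheory.HasLaw.integral_abs_pow_gaussianReal
    (hX : HasLaw X (gaussianReal 0 v) P) (n : ℕ) :
    ∫ ω, |X ω| ^ n ∂P = √v ^ n * gaussianAbsMoment n := by
  have h1 : ∫ ω, |X ω| ^ n ∂P = ∫ x, |x| ^ n ∂(gaussianReal 0 v) :=
    hX.integral_comp (f := fun x => |x| ^ n) (by fun_prop)
  have h2 : gaussianReal 0 v = (gaussianReal 0 1).map (fun x => √v * x) := by
    rw [gaussianReal_map_const_mul]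
    congr 1
    · simp
    · ext; simp
  rw [h1, h2, integral_map (by fun_prop) (by fun_prop), gaussianAbsMoment, ← integral_const_mul]
  simp [abs_mul, mul_pow, abs_of_nonneg]

lemma ProbabilityTheory.HasLaw.memLp_two_gaussianReal (hX : HasLaw X (gaussianReal 0 v) P) :
    MemLp X 2 P := by
  have h := memLp_id_gaussianReal (μ := 0) (v := v) 2
  rw [← hX.map_eq] at h
  exact (memLp_map_measure_iff (by fun_prop) hX.aemeasurable).1 h

lemma ProbabilityTheory.HasLaw.integral_gaussianReal_zero (hX : HasLaw X (gaussianReal 0 v) P) :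
    ∫ ω, X ω ∂P = 0 := by
  rw [hX.integral_eq]; exact integral_id_gaussianReal

lemma ProbabilityTheory.HasLaw.integral_sq_gaussianReal [IsProbabilityMeasure P]
    (hX : HasLaw X (gaussianReal 0 v) P) : ∫ ω, X ω ^ 2 ∂P = v := by
  have h := hX.variance_eq
  rw [variance_id_gaussianReal, variance_of_integral_eq_zero hX.aemeasurable
    hX.integral_gaussianReal_zero] at h
  exact h

end Gaussian

/-! ### Second-order expansion of the characteristic function over one increment -/

section OneStep

variable {Ω : Type*} {m mΩ : MeasurableSpace Ω} {P : Measure Ω}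

/-- Independence of `X` from `m` factorizes the mean of `f X • Z`. No integrability is assumed: if
either factor is not integrable, both sides are `0`. -/
lemma integral_smul_of_indep (hm : m ≤ mΩ) {X : Ω → ℝ} (hX : Measurable X)
    (hind : Indep (MeasurableSpace.comap X inferInstance) m P) {E : Type*} [NormedAddCommGroup E]
    [NormedSpace ℝ E] [MeasurableSpace E] [BorelSpace E] [SecondCountableTopology E]
    {f : ℝ → ℝ} (hf : Measurable f) {Z : Ω → E} (hZ : Measurable[m] Z) :
    ∫ ω, f (X ω) • Z ω ∂P = (∫ ω, f (X ω) ∂P) • ∫ ω, Z ω ∂P := by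
  have h : IndepFun (fun ω => f (X ω)) Z P := by
    rw [IndepFun_iff_Indep]
    refine indep_of_indep_of_le_left (indep_of_indep_of_le_right hind hZ.comap_le) ?_
    exact (hf.comp (comap_measurable X)).comap_le
  exact h.integral_fun_smul_eq_smul_integral (hf.comp hX).aestronglyMeasurable
    (hZ.mono hm le_rfl).aestronglyMeasurable

/-- One step of the differential equation for the characteristic function: `X` and `Y` are centred
Gaussian increments of variance `h`, independent of the past `m`, with conditional covariance `ρ h`
given `m` (tested against `Z` only), and `E` is a perturbation that is small in `L¹`. The pair
`(X, Y)` is not assumed to be Gaussian: the error is controlled by the third moments of the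
marginals. -/
theorem norm_integral_cexp_sub_one_mul_add_le [IsProbabilityMeasure P] (hm : m ≤ mΩ) {X Y : Ω → ℝ}
    (hX : Measurable X) (hY : Measurable Y) {h : NNReal}
    (lX : HasLaw X (gaussianReal 0 h) P) (lY : HasLaw Y (gaussianReal 0 h) P)
    (iX : Indep (MeasurableSpace.comap X inferInstance) m P)
    (iY : Indep (MeasurableSpace.comap Y inferInstance) m P)
    {Z : Ω → ℂ} (hZ : Measurable[m] Z) (hZ1 : ∀ ω, ‖Z ω‖ ≤ 1) {ρ : ℝ}
    (hXY : ∫ ω, (X ω * Y ω) • Z ω ∂P = (ρ * h) • ∫ ω, Z ω ∂P)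
    (a b : ℝ) {E : Ω → ℝ} (hE : Integrable E P) :
    ‖∫ ω, (Complex.exp ((a * X ω + b * Y ω + E ω : ℝ) * Complex.I) - 1) * Z ω ∂P
        + ((a ^ 2 + 2 * a * b * ρ + b ^ 2) / 2 * h) • ∫ ω, Z ω ∂P‖
      ≤ ∫ ω, |E ω| ∂P + 16 * (|a| ^ 3 + |b| ^ 3) * (√h ^ 3 * gaussianAbsMoment 3) := by
  have mZ : AEStronglyMeasurable Z P := (hZ.mono hm le_rfl).aestronglyMeasurable
  have bZ : ∀ᵐ ω ∂P, ‖Z ω‖ ≤ 1 := ae_of_all _ hZ1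
  have key : ∀ {g : Ω → ℝ}, Integrable g P → Integrable (fun ω => g ω • Z ω) P :=
    fun hg => hg.smul_bdd 1 mZ bZ
  have smulI : ∀ {f : Ω → ℂ} (c : ℝ), Integrable f P → Integrable (fun ω => c • f ω) P :=
    fun c hf => hf.smul c
  have X2 := lX.memLp_two_gaussianReal
  have Y2 := lY.memLp_two_gaussianReal
  have X1 : Integrable X P := X2.integrable (by norm_num)
  have Y1 : Integrable Y P := Y2.integrable (by norm_num)
  have XY1 : Integrable (fun ω => X ω * Y ω) P := X2.integrable_mul Y2
  have XX1 : Integrable (fun ω => X ω ^ 2) P := X2.integrable_sq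
  have YY1 : Integrable (fun ω => Y ω ^ 2) P := Y2.integrable_sq
  have eX := integral_smul_of_indep hm hX iX measurable_id hZ
  have eY := integral_smul_of_indep hm hY iY measurable_id hZ
  have eXX := integral_smul_of_indep hm hX iX (measurable_id.pow_const 2) hZ
  have eYY := integral_smul_of_indep hm hY iY (measurable_id.pow_const 2) hZ
  simp only [id, lX.integral_gaussianReal_zero, lY.integral_gaussianReal_zero,
    lX.integral_sq_gaussianReal, lY.integral_sq_gaussianReal, zero_smul] at eX eY eXX eYY
  set D : Ω → ℝ := fun ω => a * X ω + b * Y ω with hD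
  have mD : Measurable D := by fun_prop
  have iD : Integrable (fun ω => D ω • Z ω) P := key ((X1.const_mul a).add (Y1.const_mul b))
  have hDD : ∀ ω, D ω ^ 2 = a ^ 2 * X ω ^ 2 + 2 * a * b * (X ω * Y ω) + b ^ 2 * Y ω ^ 2 :=
    fun ω => by simp only [hD]; ring
  have iDD : Integrable (fun ω => D ω ^ 2 • Z ω) P := by
    refine key ?_
    simp only [hDD]
    exact ((XX1.const_mul _).add (XY1.const_mul _)).add (YY1.const_mul _)
  have ED : ∫ ω, D ω • Z ω ∂P = 0 := by
    have : ∀ ω, D ω • Z ω = a • (X ω • Z ω) + b • (Y ω • Z ω) := fun ω => by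
      simp only [hD, add_smul, mul_smul]
    simp only [this]
    rw [integral_add (smulI a (key X1)) (smulI b (key Y1)), integral_smul, integral_smul, eX, eY]
    simp
  have EDD : ∫ ω, D ω ^ 2 • Z ω ∂P = ((a ^ 2 + 2 * a * b * ρ + b ^ 2) * h) • ∫ ω, Z ω ∂P := by
    have : ∀ ω, D ω ^ 2 • Z ω = a ^ 2 • (X ω ^ 2 • Z ω) + (2 * a * b) • ((X ω * Y ω) • Z ω)
        + b ^ 2 • (Y ω ^ 2 • Z ω) := fun ω => by simp only [hDD, add_smul, mul_smul]
    simp only [this]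
    rw [integral_add ((smulI _ (key XX1)).fun_add (smulI _ (key XY1))) (smulI _ (key YY1)),
      integral_add (smulI _ (key XX1)) (smulI _ (key XY1)), integral_smul, integral_smul,
      integral_smul, eXX, eYY, hXY, ← mul_smul, ← mul_smul, ← mul_smul, ← add_smul, ← add_smul]
    congr 1; ring
  have i0 : Integrable (fun ω =>
      (Complex.exp ((D ω + E ω : ℝ) * Complex.I) - 1) * Z ω) P := by
    have hZi : Integrable Z P := Integrable.of_bound mZ 1 bZ
    have mE : AEStronglyMeasurable
        (fun ω => Complex.exp ((D ω + E ω : ℝ) * Complex.I) - 1) P := by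
      have h1 : AEStronglyMeasurable (fun ω => D ω + E ω) P :=
        mD.aestronglyMeasurable.add hE.aestronglyMeasurable
      have h2 : Continuous fun x : ℝ => Complex.exp (x * Complex.I) - 1 := by fun_prop
      exact h2.comp_aestronglyMeasurable h1
    refine hZi.bdd_mul (c := 2) mE (ae_of_all _ fun ω => ?_)
    refine (norm_sub_le _ _).trans ?_
    rw [Complex.norm_exp_ofReal_mul_I]; norm_num
  have split : ∫ ω, (Complex.exp ((D ω + E ω : ℝ) * Complex.I) - 1) * Z ω ∂P
        + ((a ^ 2 + 2 * a * b * ρ + b ^ 2) / 2 * h) • ∫ ω, Z ω ∂P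
      = ∫ ω, (Complex.exp ((D ω + E ω : ℝ) * Complex.I) - 1 - D ω * Complex.I
          + (D ω : ℂ) ^ 2 / 2) * Z ω ∂P := by
    have : ∀ ω, (Complex.exp ((D ω + E ω : ℝ) * Complex.I) - 1 - D ω * Complex.I
          + (D ω : ℂ) ^ 2 / 2) * Z ω = (Complex.exp ((D ω + E ω : ℝ) * Complex.I) - 1) * Z ω
          - Complex.I • (D ω • Z ω) + (1 / 2 : ℝ) • (D ω ^ 2 • Z ω) := fun ω => by
      simp only [Complex.real_smul, smul_eq_mul]; push_cast; ring
    simp only [this]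
    have iD' : Integrable (fun ω => Complex.I • (D ω • Z ω)) P := iD.smul Complex.I
    have i1 : Integrable (fun ω => (Complex.exp ((D ω + E ω : ℝ) * Complex.I) - 1) * Z ω
        - Complex.I • (D ω • Z ω)) P := i0.sub iD'
    rw [integral_add i1 (smulI _ iDD), integral_sub i0 iD',
      integral_smul, integral_smul, ED, EDD, ← mul_smul]
    simp only [smul_zero, sub_zero]
    congr 2; ring
  have X3 := lX.integrable_abs_pow_gaussianReal 3
  have Y3 := lY.integrable_abs_pow_gaussianReal 3
  have bound : ∀ ω, ‖(Complex.exp ((D ω + E ω : ℝ) * Complex.I) - 1 - D ω * Complex.I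
          + (D ω : ℂ) ^ 2 / 2) * Z ω‖
        ≤ |E ω| + (16 * |a| ^ 3 * |X ω| ^ 3 + 16 * |b| ^ 3 * |Y ω| ^ 3) := by
    intro ω
    have h1 := norm_cexp_mul_I_sub_cexp_mul_I_le (D ω + E ω) (D ω)
    have h2 := norm_cexp_mul_I_sub_taylor_two_le (D ω)
    rw [add_sub_cancel_left] at h1
    have h3 : |D ω| ≤ |a| * |X ω| + |b| * |Y ω| := by
      simp only [hD]; exact (abs_add_le _ _).trans (by rw [abs_mul, abs_mul])
    -- Convexity of the cube: `(p + q) ^ 3 ≤ 4 (p ^ 3 + q ^ 3)` for nonnegative `p` and `q`.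
    have h4 : |D ω| ^ 3 ≤ 4 * ((|a| * |X ω|) ^ 3 + (|b| * |Y ω|) ^ 3) := by
      refine (pow_le_pow_left₀ (abs_nonneg _) h3 3).trans ?_
      have hp : 0 ≤ |a| * |X ω| := by positivity
      have hq : 0 ≤ |b| * |Y ω| := by positivity
      nlinarith [mul_nonneg (add_nonneg hp hq) (sq_nonneg (|a| * |X ω| - |b| * |Y ω|))]
    rw [norm_mul]
    calc _ ≤ ‖Complex.exp ((D ω + E ω : ℝ) * Complex.I) - 1 - D ω * Complex.I
          + (D ω : ℂ) ^ 2 / 2‖ * 1 := by gcongr; exact hZ1 ω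
      _ = ‖(Complex.exp ((D ω + E ω : ℝ) * Complex.I) - Complex.exp (D ω * Complex.I))
          + (Complex.exp (D ω * Complex.I) - 1 - D ω * Complex.I + (D ω : ℂ) ^ 2 / 2)‖ := by
          rw [mul_one]; congr 1; ring
      _ ≤ |E ω| + 4 * |D ω| ^ 3 := (norm_add_le _ _).trans (add_le_add h1 h2)
      _ ≤ _ := by rw [mul_pow, mul_pow] at h4; linarith
  rw [show (fun ω => (Complex.exp ((a * X ω + b * Y ω + E ω : ℝ) * Complex.I) - 1) * Z ω)
    = fun ω => (Complex.exp ((D ω + E ω : ℝ) * Complex.I) - 1) * Z ω from rfl, split]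
  have iR : Integrable (fun ω => 16 * |a| ^ 3 * |X ω| ^ 3 + 16 * |b| ^ 3 * |Y ω| ^ 3) P :=
    (X3.const_mul _).add (Y3.const_mul _)
  refine (norm_integral_le_of_norm_le (hE.abs.add iR) (ae_of_all _ bound)).trans (le_of_eq ?_)
  simp only [Pi.add_apply]
  rw [integral_add hE.abs iR, integral_add (X3.const_mul _) (Y3.const_mul _),
    integral_const_mul, integral_const_mul, lX.integral_abs_pow_gaussianReal,
    lY.integral_abs_pow_gaussianReal]
  ring

end OneStep

/-! ### Pathwise solution of the linear equation -/

/-- Variation of constants for `r = -κ ∫ r + w` with a continuous, possibly nowhere differentiable,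
forcing `w`. Integration by parts has been carried out, so that only increments of `w` over
subintervals of `[u, v]` appear. -/
lemma exp_mul_sub_exp_mul_eq_of_integral_eq {κ T : ℝ} {r w : ℝ → ℝ} (hr : Continuous r)
    (hw : Continuous w)
    (heq : ∀ t ∈ Set.Icc 0 T, r t = -κ * (∫ s in (0 : ℝ)..t, r s) + w t) {u v : ℝ} (hu : 0 ≤ u)
    (huv : u ≤ v) (hv : v ≤ T) :
    Real.exp (κ * v) * r v - Real.exp (κ * u) * r u
      = Real.exp (κ * u) * (w v - w u) + κ * ∫ s in u..v, Real.exp (κ * s) * (w v - w s) := by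
  set A : ℝ → ℝ := fun t => ∫ s in (0 : ℝ)..t, r s with hA
  have dA : ∀ t, HasDerivAt A (r t) t := fun t => hr.integral_hasStrictDerivAt 0 t |>.hasDerivAt
  have de : ∀ t, HasDerivAt (fun t => Real.exp (κ * t)) (Real.exp (κ * t) * κ) t := fun t => by
    simpa using ((hasDerivAt_id t).const_mul κ).exp
  -- `exp (κ t) ∫ s in 0..t, r s` is an antiderivative of `exp (κ t) w t`, by the equation for `r`.
  have h1 : ∫ s in u..v, Real.exp (κ * s) * w s
      = Real.exp (κ * v) * A v - Real.exp (κ * u) * A u := by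
    refine intervalIntegral.integral_eq_sub_of_hasDerivAt
      (f := fun t => Real.exp (κ * t) * A t) (fun t ht => ?_)
      (Continuous.intervalIntegrable (by fun_prop) _ _)
    rw [Set.uIcc_of_le huv] at ht
    refine ((de t).mul (dA t)).congr_deriv ?_
    rw [heq t ⟨hu.trans ht.1, ht.2.trans hv⟩]
    simp only [hA]; ring
  have h2 : ∫ s in u..v, κ * Real.exp (κ * s) = Real.exp (κ * v) - Real.exp (κ * u) :=
    intervalIntegral.integral_eq_sub_of_hasDerivAt
      (f := fun t => Real.exp (κ * t)) (fun t _ => (de t).congr_deriv (mul_comm _ _))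
      (Continuous.intervalIntegrable (by fun_prop) _ _)
  have h3 : ∫ s in u..v, Real.exp (κ * s) * (w v - w s)
      = (∫ s in u..v, Real.exp (κ * s)) * w v - ∫ s in u..v, Real.exp (κ * s) * w s := by
    rw [← intervalIntegral.integral_mul_const, ← intervalIntegral.integral_sub
      (Continuous.intervalIntegrable (by fun_prop) _ _)
      (Continuous.intervalIntegrable (by fun_prop) _ _)]
    simp only [mul_sub]
  rw [intervalIntegral.integral_const_mul] at h2
  rw [h3, mul_sub κ, ← mul_assoc, h2, h1, heq v ⟨hu.trans huv, hv⟩, heq u ⟨hu, huv.trans hv⟩]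
  simp only [hA]; ring

lemma setIntegral_Iic_comap_subtype_val {T : ℝ} (hT : 0 ≤ T) (f : Set.Icc (0 : ℝ) T → ℝ)
    (t : Set.Icc (0 : ℝ) T) :
    ∫ s in Set.Iic t, f s ∂(Measure.comap Subtype.val volume)
      = ∫ s in (0 : ℝ)..t, f (Set.projIcc 0 T hT s) := by
  have hval : MeasurableEmbedding (Subtype.val : Set.Icc (0 : ℝ) T → ℝ) :=
    MeasurableEmbedding.subtype_coe measurableSet_Icc
  have himg : Subtype.val '' (Set.Iic t) = Set.Icc (0 : ℝ) t := by
    ext x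
    constructor
    · rintro ⟨y, hy, rfl⟩; exact ⟨y.2.1, hy⟩
    · intro hx; exact ⟨⟨x, hx.1, hx.2.trans t.2.2⟩, hx.2, rfl⟩
  rw [intervalIntegral.integral_of_le t.2.1, ← integral_Icc_eq_integral_Ioc, ← himg,
    ← Measure.restrict_restrict_of_subset (t := Set.Icc (0 : ℝ) T)
      (himg ▸ Set.Icc_subset_Icc_right t.2.2),
    ← map_comap_subtype_coe measurableSet_Icc, hval.restrict_map,
    Set.preimage_image_eq _ Subtype.val_injective, hval.integral_map]
  simp

/-! ### The increments of the solution up to order `3 / 2` in `L¹` -/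

section L1

variable {Ω : Type*} {mΩ : MeasurableSpace Ω} {P : Measure Ω}

/-- A measurable process with almost surely continuous paths is indistinguishable from a jointly
measurable one: the paths are replaced by `0` on a measurable null set that contains all
discontinuous ones. -/
lemma exists_measurable_uncurry_of_ae_continuous {ι : Type*} [TopologicalSpace ι]
    [TopologicalSpace.MetrizableSpace ι] [MeasurableSpace ι] [SecondCountableTopology ι]
    [OpensMeasurableSpace ι] {W : ι → Ω → ℝ} (hW : ∀ i, Measurable (W i))
    (hc : ∀ᵐ ω ∂P, Continuous fun i => W i ω) :
    ∃ W' : ι → Ω → ℝ, Measurable (Function.uncurry W') ∧ ∀ᵐ ω ∂P, ∀ i, W' i ω = W i ω := by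
  set B := toMeasurable P {ω | ¬ Continuous fun i => W i ω} with hB
  have hB0 : P B = 0 := by rw [hB, measure_toMeasurable]; exact hc
  have hBm : MeasurableSet B := measurableSet_toMeasurable _ _
  have hmem : ∀ ω, ω ∈ Bᶜ → Continuous fun i => W i ω := fun ω hω => by
    by_contra h; exact hω (subset_toMeasurable _ _ h)
  refine ⟨fun i => Bᶜ.indicator (W i), ?_, ?_⟩
  · refine measurable_uncurry_of_continuous_of_measurable (fun ω => ?_)
      fun i => (hW i).indicator hBm.compl
    by_cases hω : ω ∈ Bᶜ
    · simpa only [Set.indicator_of_mem hω] using hmem ω hω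
    · simpa only [Set.indicator_of_notMem hω] using continuous_const
  · filter_upwards [measure_eq_zero_iff_ae_notMem.1 hB0] with ω hω i
    exact Set.indicator_of_mem (s := Bᶜ) hω _

/-- Minkowski's inequality in `L¹` for an integral over a time interval. -/
lemma integrable_intervalIntegral_and_integral_abs_le [SFinite P] {f : ℝ → Ω → ℝ}
    (hf : Measurable (Function.uncurry f)) {u v C : ℝ} (huv : u ≤ v) (hC : 0 ≤ C)
    (hfi : ∀ s ∈ Set.Ioc u v, Integrable (f s) P) (hfC : ∀ s ∈ Set.Ioc u v, ∫ ω, |f s ω| ∂P ≤ C) :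
    Integrable (fun ω => ∫ s in u..v, f s ω) P ∧ ∫ ω, |∫ s in u..v, f s ω| ∂P ≤ C * (v - u) := by
  have hm : AEStronglyMeasurable (fun ω => ∫ s in u..v, f s ω) P := by
    simp only [intervalIntegral.integral_of_le huv]
    exact (StronglyMeasurable.integral_prod_right (f := fun ω s => f s ω)
      (hf.comp measurable_swap).stronglyMeasurable).aestronglyMeasurable
  have hle : ∫⁻ ω, ‖∫ s in u..v, f s ω‖ₑ ∂P ≤ ENNReal.ofReal (C * (v - u)) := by
    calc ∫⁻ ω, ‖∫ s in u..v, f s ω‖ₑ ∂P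
        ≤ ∫⁻ ω, (∫⁻ s in Set.Ioc u v, ‖f s ω‖ₑ) ∂P := by
          refine lintegral_mono fun ω => ?_
          rw [intervalIntegral.integral_of_le huv]
          exact enorm_integral_le_lintegral_enorm _
      _ = ∫⁻ s in Set.Ioc u v, (∫⁻ ω, ‖f s ω‖ₑ ∂P) :=
          lintegral_lintegral_swap (hf.comp measurable_swap).enorm.aemeasurable
      _ ≤ ∫⁻ s in Set.Ioc u v, ENNReal.ofReal C := by
          refine setLIntegral_mono measurable_const fun s hs => ?_
          rw [← ofReal_integral_norm_eq_lintegral_enorm (hfi s hs)]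
          exact ENNReal.ofReal_le_ofReal (hfC s hs)
      _ = _ := by
          rw [setLIntegral_const, Real.volume_Ioc, ENNReal.ofReal_mul hC]
  have hi : Integrable (fun ω => ∫ s in u..v, f s ω) P :=
    ⟨hm, hle.trans_lt ENNReal.ofReal_lt_top⟩
  refine ⟨hi, ?_⟩
  have := ofReal_integral_norm_eq_lintegral_enorm hi
  rw [← this] at hle
  exact (ENNReal.ofReal_le_ofReal_iff (mul_nonneg hC (sub_nonneg.2 huv))).1 hle

/-- The increment of `exp (κ t) R t` over `[u, v]` equals `exp (κ u) (W v - W u)` up to an error of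
order `(v - u) ^ (3 / 2)` in `L¹`. -/
theorem IsVasicekSolution.integral_abs_exp_mul_increment_sub_le [IsProbabilityMeasure P] {T κ : ℝ}
    (hκ : 0 < κ) {F : Filtration (Set.Icc (0 : ℝ) T) mΩ} {W R : Set.Icc (0 : ℝ) T → Ω → ℝ}
    (hR : IsVasicekSolution F κ W R P) (hW : IsWienerProcess F W P) {u v : Set.Icc (0 : ℝ) T}
    (huv : u ≤ v) :
    Integrable (fun ω => Real.exp (κ * v) * R v ω - Real.exp (κ * u) * R u ω
        - Real.exp (κ * u) * (W v ω - W u ω)) P ∧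
      ∫ ω, |Real.exp (κ * v) * R v ω - Real.exp (κ * u) * R u ω
        - Real.exp (κ * u) * (W v ω - W u ω)| ∂P
        ≤ κ * Real.exp (κ * T) * gaussianAbsMoment 1 * ((v - u) * √(v - u)) := by
  have hT : 0 ≤ T := u.2.1.trans u.2.2
  have huv' : (u : ℝ) ≤ v := huv
  have proj : ∀ t : Set.Icc (0 : ℝ) T, Set.projIcc 0 T hT t = t := Set.projIcc_val hT
  obtain ⟨W', mW', eW'⟩ := exists_measurable_uncurry_of_ae_continuous
    (fun t => (hW.adapted t).mono (F.le t) le_rfl) hW.continuous_paths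
  have mW'' : ∀ t, Measurable (W' t) := fun t => mW'.comp measurable_prodMk_left
  set f : ℝ → Ω → ℝ := fun s ω =>
    κ * (Real.exp (κ * s) * (W' v ω - W' (Set.projIcc 0 T hT s) ω)) with hf
  have mf : Measurable (Function.uncurry f) := by
    have h1 : Measurable fun p : ℝ × Ω => W' (Set.projIcc 0 T hT p.1) p.2 :=
      mW'.comp (((continuous_projIcc (h := hT)).measurable.comp measurable_fst).prodMk measurable_snd)
    have h2 : Measurable fun p : ℝ × Ω => W' v p.2 := (mW'' v).comp measurable_snd
    exact measurable_const.mul ((Real.measurable_exp.comp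
      (measurable_const.mul measurable_fst)).mul (h2.sub h1))
  have hae : (fun ω => Real.exp (κ * v) * R v ω - Real.exp (κ * u) * R u ω
        - Real.exp (κ * u) * (W v ω - W u ω)) =ᵐ[P] fun ω => ∫ s in (u : ℝ)..v, f s ω := by
    filter_upwards [eW', hW.continuous_paths, hR.continuous_paths, hR.integral_eq]
      with ω h1 h2 h3 h4
    have := exp_mul_sub_exp_mul_eq_of_integral_eq (κ := κ) (T := T)
      (r := fun s => R (Set.projIcc 0 T hT s) ω) (w := fun s => W (Set.projIcc 0 T hT s) ω)
      (h3.comp continuous_projIcc) (h2.comp continuous_projIcc)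
      (fun t ht => by
        have h := h4 ⟨t, ht⟩
        rw [setIntegral_Iic_comap_subtype_val hT (fun s => R s ω)] at h
        simpa only [Set.projIcc_of_mem hT ht] using h) u.2.1 huv' v.2.2
    simp only [proj] at this
    simp only [hf, intervalIntegral.integral_const_mul, this, h1]
    ring
  have law : ∀ s ∈ Set.Ioc (u : ℝ) v, HasLaw (fun ω => W' v ω - W' (Set.projIcc 0 T hT s) ω)
      (gaussianReal 0 (Real.toNNReal ((v : ℝ) - s))) P := fun s hs => by
    have hsT : s ∈ Set.Icc 0 T := ⟨u.2.1.trans hs.1.le, hs.2.trans v.2.2⟩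
    have h := hW.increment_law ⟨s, hsT⟩ v hs.2
    rw [Set.projIcc_of_mem hT hsT]
    refine h.congr ?_
    filter_upwards [eW'] with ω hω
    rw [hω, hω]
  have hint := integrable_intervalIntegral_and_integral_abs_le (P := P) mf huv'
    (C := κ * Real.exp (κ * T) * gaussianAbsMoment 1 * √(v - u)) (by
      have := gaussianAbsMoment_nonneg 1
      positivity)
    (fun s hs => by
      have h := (law s hs).memLp_two_gaussianReal.integrable (by norm_num)
      exact (h.const_mul _).const_mul _)
    (fun s hs => by
      have h := (law s hs).integral_abs_pow_gaussianReal 1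
      simp only [pow_one] at h
      simp only [hf, abs_mul, integral_const_mul, h, abs_of_pos hκ, Real.abs_exp]
      rw [Real.coe_toNNReal _ (sub_nonneg.2 hs.2), mul_assoc, mul_assoc,
        mul_comm (√_)]
      have := gaussianAbsMoment_nonneg 1
      have := hs.1.le
      gcongr
      exact hs.2.trans v.2.2)
  refine ⟨hint.1.congr hae.symm, ?_⟩
  rw [integral_congr_ae (hae.mono fun ω h => congrArg abs h)]
  refine hint.2.trans (le_of_eq (by ring))

end L1

/-! ### A linear differential equation from an approximate one-step relation -/

section ODE

open Filter Topology Asymptotics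

/-- A function that satisfies `φ t = (1 - q s (t - s)) φ s + O((t - s) ^ (3 / 2))` uniformly for
`s ≤ t` solves `φ' = -q φ`, because the exponent of the error exceeds `1`. -/
theorem eq_exp_smul_of_norm_sub_add_smul_le {φ : ℝ → ℂ} {q Q : ℝ → ℝ} {a b C : ℝ} (hab : a ≤ b)
    (hq : Continuous q) (hQ : ∀ s, HasDerivAt Q (q s) s) (hφ : ∀ s ∈ Set.Icc a b, ‖φ s‖ ≤ 1)
    (h : ∀ s ∈ Set.Icc a b, ∀ t ∈ Set.Icc a b, s ≤ t →
      ‖φ t - φ s + (q s * (t - s)) • φ s‖ ≤ C * ((t - s) * √(t - s))) :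
    φ b = Real.exp (Q a - Q b) • φ a := by
  -- The relation starts at the left end point `s`, so it gives right derivatives only; the mean value
  -- theorem for right derivatives also needs the continuity of `φ`, shown next.
  have hder : ∀ s ∈ Set.Ico a b, HasDerivWithinAt φ (-(q s • φ s)) (Set.Ici s) s := by
    intro s hs
    rw [hasDerivWithinAt_iff_isLittleO, isLittleO_iff]
    intro c hc
    have hlim : Tendsto (fun t => C * √(t - s)) (𝓝[Set.Ici s] s) (𝓝 0) := by
      have : Continuous fun t => C * √(t - s) := by fun_prop
      simpa using (this.tendsto s).mono_left nhdsWithin_le_nhds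
    filter_upwards [hlim.eventually (ge_mem_nhds hc), self_mem_nhdsWithin,
      nhdsWithin_le_nhds (Iic_mem_nhds hs.2)] with t h1 h2 h3
    have h2' : s ≤ t := h2
    have h4 := h s ⟨hs.1, hs.2.le⟩ t ⟨hs.1.trans h2, h3⟩ h2
    calc _ = ‖φ t - φ s + (q s * (t - s)) • φ s‖ := by
          congr 1; rw [smul_neg, sub_neg_eq_add, ← mul_smul, mul_comm]
      _ ≤ C * √(t - s) * (t - s) := h4.trans (le_of_eq (by ring))
      _ ≤ c * (t - s) := mul_le_mul_of_nonneg_right h1 (sub_nonneg.2 h2)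
      _ = _ := by rw [Real.norm_of_nonneg (sub_nonneg.2 h2')]
  have hcont : ContinuousOn φ (Set.Icc a b) := by
    obtain ⟨K, hK⟩ := isCompact_Icc.exists_bound_of_continuousOn (hq.continuousOn (s := Set.Icc a b))
    have hle : ∀ s ∈ Set.Icc a b, ∀ t ∈ Set.Icc a b, s ≤ t →
        dist (φ t) (φ s) ≤ C * (|t - s| * √|t - s|) + K * |t - s| := by
      intro s hs t ht hst
      have h1 := h s hs t ht hst
      rw [abs_of_nonneg (sub_nonneg.2 hst), dist_eq_norm]
      have h2 : ‖(q s * (t - s)) • φ s‖ ≤ K * (t - s) := by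
        rw [norm_smul, norm_mul, Real.norm_of_nonneg (sub_nonneg.2 hst)]
        have h3 := mul_le_mul_of_nonneg_right (hK s hs) (sub_nonneg.2 hst)
        have h4 : 0 ≤ ‖q s‖ * (t - s) := mul_nonneg (norm_nonneg _) (sub_nonneg.2 hst)
        nlinarith [hφ s hs]
      calc _ = ‖(φ t - φ s + (q s * (t - s)) • φ s) - (q s * (t - s)) • φ s‖ := by
            rw [add_sub_cancel_right]
        _ ≤ _ := (norm_sub_le _ _).trans (add_le_add h1 h2)
    intro s hs
    rw [ContinuousWithinAt, tendsto_iff_dist_tendsto_zero]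
    have hlim : Tendsto (fun t => C * (|t - s| * √|t - s|) + K * |t - s|) (𝓝[Set.Icc a b] s)
        (𝓝 0) := by
      have : Continuous fun t => C * (|t - s| * √|t - s|) + K * |t - s| := by fun_prop
      simpa using (this.tendsto s).mono_left nhdsWithin_le_nhds
    refine squeeze_zero' (Eventually.of_forall fun _ => dist_nonneg) ?_ hlim
    filter_upwards [self_mem_nhdsWithin] with t ht
    rcases le_total s t with hst | hst
    · exact hle s hs t ht hst
    · rw [dist_comm, abs_sub_comm]; exact hle t ht s hs hst
  have hQc : Continuous Q := continuous_iff_continuousAt.2 fun s => (hQ s).continuousAt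
  have hconst := constant_of_has_deriv_right_zero (f := fun s => Real.exp (Q s) • φ s)
    ((Real.continuous_exp.comp hQc).continuousOn.smul hcont) (fun s hs => by
      have h1 := ((hQ s).exp.hasDerivWithinAt (s := Set.Ici s)).smul (hder s hs)
      refine h1.congr_deriv ?_
      rw [smul_neg, ← mul_smul, neg_add_cancel]) b ⟨hab, le_rfl⟩
  rw [sub_eq_neg_add, Real.exp_add, mul_smul, ← hconst, ← mul_smul, ← Real.exp_add,
    neg_add_cancel, Real.exp_zero, one_smul]

end ODE

/-! ### Conditional characteristic function of the increments -/

section CharFun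

variable {Ω : Type*} {mΩ : MeasurableSpace Ω} {P : Measure Ω} {T : ℝ}
  {F : Filtration (Set.Icc (0 : ℝ) T) mΩ}

lemma IsWienerProcess.memLp_two {W : Set.Icc (0 : ℝ) T → Ω → ℝ} (hW : IsWienerProcess F W P)
    (t : Set.Icc (0 : ℝ) T) : MemLp (W t) 2 P := by
  have h0 : (0 : ℝ) ∈ Set.Icc 0 T := ⟨le_rfl, t.2.1.trans t.2.2⟩
  refine ((hW.increment_law ⟨0, h0⟩ t t.2.1).memLp_two_gaussianReal).ae_eq ?_
  filter_upwards [hW.zero ⟨0, h0⟩ rfl] with ω hω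
  rw [hω, sub_zero]

lemma IsWienerProcess.measurable {W : Set.Icc (0 : ℝ) T → Ω → ℝ} (hW : IsWienerProcess F W P)
    (t : Set.Icc (0 : ℝ) T) : Measurable (W t) := (hW.adapted t).mono (F.le t) le_rfl

/-- Martingale increments are orthogonal to bounded complex variables from the past. -/
lemma MeasureTheory.Martingale.integral_sub_smul_eq_zero [IsProbabilityMeasure P]
    {ι : Type*} [Preorder ι]
    {G : Filtration ι mΩ} {M : ι → Ω → ℝ} (hM : Martingale M G P) {u v : ι} (huv : u ≤ v)
    {Z : Ω → ℂ} (hZ : Measurable[G u] Z) (hZ1 : ∀ ω, ‖Z ω‖ ≤ 1) :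
    ∫ ω, (M v ω - M u ω) • Z ω ∂P = 0 := by
  have mZ : AEStronglyMeasurable Z P := (hZ.mono (G.le u) le_rfl).aestronglyMeasurable
  have iv : Integrable (M v • Z) P := (hM.integrable v).smul_bdd 1 mZ (ae_of_all _ hZ1)
  have iu : Integrable (M u • Z) P := (hM.integrable u).smul_bdd 1 mZ (ae_of_all _ hZ1)
  have h1 := condExp_smul_of_aestronglyMeasurable_right (m := G u) (hM.integrable v) iv
    hZ.stronglyMeasurable.aestronglyMeasurable
  have h2 : ∫ ω, (M v • Z) ω ∂P = ∫ ω, (M u • Z) ω ∂P := by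
    rw [← integral_condExp (G.le u)]
    refine integral_congr_ae ?_
    filter_upwards [h1, hM.condExp_ae_eq huv] with ω h3 h4
    rw [h3, Pi.smul_apply', Pi.smul_apply', h4]
  rw [← sub_eq_zero, ← integral_sub iv iu] at h2
  simpa only [Pi.smul_apply', ← sub_smul] using h2

/-- The bracket gives the conditional covariance of the increments: `ΔV ΔW` differs from the
increment of `V W` by the cross terms `V u ΔW` and `W u ΔV`, which have conditional mean `0`. -/
lemma integral_increment_mul_increment_smul [IsProbabilityMeasure P] {ρ : ℝ}
    {V W : Set.Icc (0 : ℝ) T → Ω → ℝ}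
    (hV : IsWienerProcess F V P) (hW : IsWienerProcess F W P)
    (hcov : IsCrossVariation F V W (fun t _ => ρ * (t : ℝ)) P) {u v : Set.Icc (0 : ℝ) T}
    (huv : u ≤ v) {Z : Ω → ℂ} (hZ : Measurable[F u] Z) (hZ1 : ∀ ω, ‖Z ω‖ ≤ 1) :
    ∫ ω, ((V v ω - V u ω) * (W v ω - W u ω)) • Z ω ∂P
      = (ρ * ((v : ℝ) - u)) • ∫ ω, Z ω ∂P := by
  have mZ : AEStronglyMeasurable Z P := (hZ.mono (F.le u) le_rfl).aestronglyMeasurable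
  have bZ : ∀ᵐ ω ∂P, ‖Z ω‖ ≤ 1 := ae_of_all _ hZ1
  have key : ∀ {g : Ω → ℝ}, Integrable g P → Integrable (fun ω => g ω • Z ω) P :=
    fun hg => hg.smul_bdd 1 mZ bZ
  have cross : ∀ {A B : Set.Icc (0 : ℝ) T → Ω → ℝ}, IsWienerProcess F A P →
      IsWienerProcess F B P → Integrable (fun ω => (B v ω - B u ω) * A u ω) P ∧
        ∫ ω, ((B v ω - B u ω) * A u ω) • Z ω ∂P = 0 := by
    intro A B hA hB
    refine ⟨((hB.memLp_two v).sub (hB.memLp_two u)).integrable_mul (hA.memLp_two u), ?_⟩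
    have h := integral_smul_of_indep (P := P) (F.le u) ((hB.measurable v).sub (hB.measurable u))
      (hB.increment_indep u v huv) measurable_id ((hA.adapted u).smul hZ)
    have h0 := (hB.increment_law u v huv).integral_gaussianReal_zero
    simp only [id, Pi.smul_apply', Pi.sub_apply] at h
    simp only [mul_smul, h, h0, zero_smul]
  obtain ⟨i1, e1⟩ := cross hV hW
  obtain ⟨i2, e2⟩ := cross hW hV
  have eM := hcov.martingale.integral_sub_smul_eq_zero huv hZ hZ1
  have iM : Integrable (fun ω => (V v ω * W v ω - ρ * v) - (V u ω * W u ω - ρ * u)) P :=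
    (hcov.martingale.integrable v).sub (hcov.martingale.integrable u)
  have iZ : Integrable (fun ω => (ρ * ((v : ℝ) - u)) • Z ω) P := key (integrable_const _)
  have hsplit : ∀ ω, ((V v ω - V u ω) * (W v ω - W u ω)) • Z ω
      = ((V v ω * W v ω - ρ * v) - (V u ω * W u ω - ρ * u)) • Z ω + (ρ * ((v : ℝ) - u)) • Z ω
        - ((W v ω - W u ω) * V u ω) • Z ω - ((V v ω - V u ω) * W u ω) • Z ω := fun ω => by
    rw [← add_smul, ← sub_smul, ← sub_smul]; congr 1; ring
  simp only [hsplit]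
  have j1 := (key iM).add iZ
  have j2 := j1.sub (key i1)
  rw [integral_sub (by exact j2) (key i2), integral_sub (by exact j1) (key i1),
    integral_add (key iM) iZ, eM, e1, e2, integral_smul]
  simp

/-- The conditional characteristic function, given `F t₀`, of the increments of `V` and of
`exp (κ t) R t`. The exponent is that of a Gaussian vector whose covariance matrix has the entries
`∫ 1`, `ρ ∫ exp (κ s)` and `∫ exp (2 κ s)` over `[t₀, t₁]`. -/
theorem integral_cexp_increments_mul [IsProbabilityMeasure P] {κ ρ : ℝ} (hκ : 0 < κ)
    {V W R : Set.Icc (0 : ℝ) T → Ω → ℝ}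
    (hV : IsWienerProcess F V P) (hW : IsWienerProcess F W P)
    (hcov : IsCrossVariation F V W (fun t _ => ρ * (t : ℝ)) P)
    (hR : IsVasicekSolution F κ W R P) {t₀ t₁ : Set.Icc (0 : ℝ) T} (ht : t₀ ≤ t₁)
    {Z : Ω → ℂ} (hZ : Measurable[F t₀] Z) (hZ1 : ∀ ω, ‖Z ω‖ ≤ 1) (a b : ℝ) :
    ∫ ω, Complex.exp ((a * (V t₁ ω - V t₀ ω)
        + b * (Real.exp (κ * t₁) * R t₁ ω - Real.exp (κ * t₀) * R t₀ ω) : ℝ) * Complex.I)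
        * Z ω ∂P
      = Real.exp (-(a ^ 2 * ((t₁ : ℝ) - t₀)
          + 2 * a * b * ρ * ((Real.exp (κ * t₁) - Real.exp (κ * t₀)) / κ)
          + b ^ 2 * ((Real.exp (κ * t₁) ^ 2 - Real.exp (κ * t₀) ^ 2) / (2 * κ))) / 2)
        • ∫ ω, Z ω ∂P := by
  have hT : 0 ≤ T := t₀.2.1.trans t₀.2.2
  set N : Set.Icc (0 : ℝ) T → Ω → ℝ := fun t ω => Real.exp (κ * t) * R t ω with hN
  set L : Set.Icc (0 : ℝ) T → Ω → ℝ := fun t ω =>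
    a * (V t ω - V t₀ ω) + b * (N t ω - N t₀ ω) with hL
  set Y : Set.Icc (0 : ℝ) T → Ω → ℂ := fun t ω => Complex.exp (L t ω * Complex.I) * Z ω with hY
  set q : ℝ → ℝ := fun s =>
    (a ^ 2 + 2 * a * (b * Real.exp (κ * s)) * ρ + (b * Real.exp (κ * s)) ^ 2) / 2 with hq
  -- `Q` is an antiderivative of `q`.
  set Q : ℝ → ℝ := fun s => (a ^ 2 * s + 2 * a * b * ρ * (Real.exp (κ * s) / κ)
    + b ^ 2 * (Real.exp (κ * s) ^ 2 / (2 * κ))) / 2 with hQ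
  have hQq : ∀ s, HasDerivAt Q (q s) s := fun s => by
    have de : HasDerivAt (fun t => Real.exp (κ * t)) (Real.exp (κ * s) * κ) s := by
      simpa using ((hasDerivAt_id s).const_mul κ).exp
    refine (((((hasDerivAt_id s).const_mul (a ^ 2)).add
      ((de.div_const κ).const_mul (2 * a * b * ρ))).add
      (((de.pow 2).div_const (2 * κ)).const_mul (b ^ 2))).div_const 2).congr_deriv ?_
    simp only [hq]; field_simp; push_cast; ring
  have mY : ∀ t, t₀ ≤ t → Measurable[F t] (Y t) := fun t ht' => by
    have mV : Measurable[F t] (V t₀) := (hV.adapted t₀).mono (F.mono ht') le_rfl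
    have mR : Measurable[F t] (R t₀) := (hR.adapted t₀).mono (F.mono ht') le_rfl
    have mL : Measurable[F t] (L t) :=
      (((hV.adapted t).sub mV).const_mul a).add
        ((((hR.adapted t).const_mul _).sub (mR.const_mul _)).const_mul b)
    have hc : Measurable fun x : ℝ => Complex.exp (x * Complex.I) := by fun_prop
    exact (hc.comp mL).mul (hZ.mono (F.mono ht') le_rfl)
  have bY : ∀ t ω, ‖Y t ω‖ ≤ 1 := fun t ω => by
    simp only [hY]
    rw [norm_mul, Complex.norm_exp_ofReal_mul_I, one_mul]; exact hZ1 ω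
  have iY : ∀ t, t₀ ≤ t → Integrable (Y t) P := fun t ht' =>
    Integrable.of_bound ((mY t ht').mono (F.le t) le_rfl).aestronglyMeasurable 1
      (ae_of_all _ (bY t))
  set C : ℝ := |b| * (κ * Real.exp (κ * T) * gaussianAbsMoment 1)
    + 16 * (|a| ^ 3 + |b * Real.exp (κ * T)| ^ 3) * gaussianAbsMoment 3 with hC
  have step : ∀ u v : Set.Icc (0 : ℝ) T, t₀ ≤ u → u ≤ v →
      ‖∫ ω, Y v ω ∂P - ∫ ω, Y u ω ∂P + (q u * ((v : ℝ) - u)) • ∫ ω, Y u ω ∂P‖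
        ≤ C * (((v : ℝ) - u) * √((v : ℝ) - u)) := by
    intro u v hu huv
    have huv' : (u : ℝ) ≤ v := huv
    have hsub : 0 ≤ (v : ℝ) - u := sub_nonneg.2 huv'
    obtain ⟨iE, bE⟩ := hR.integral_abs_exp_mul_increment_sub_le hκ hW huv
    have hXY := integral_increment_mul_increment_smul hV hW hcov huv (mY u hu) (bY u)
    have h := norm_integral_cexp_sub_one_mul_add_le (F.le u)
      ((hV.measurable v).sub (hV.measurable u)) ((hW.measurable v).sub (hW.measurable u))
      (hV.increment_law u v huv) (hW.increment_law u v huv)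
      (hV.increment_indep u v huv) (hW.increment_indep u v huv) (mY u hu) (bY u) (ρ := ρ)
      (by rw [Real.coe_toNNReal _ hsub]; exact hXY) a (b * Real.exp (κ * u)) (iE.const_mul b)
    rw [Real.coe_toNNReal _ hsub] at h
    -- The characters multiply along increments, so the one-step bound applies with the
    -- `F u`-measurable factor `Y u` in place of `Z`.
    have hYv : ∀ ω, Y v ω - Y u ω = (Complex.exp ((a * (V v - V u) ω
        + b * Real.exp (κ * u) * (W v - W u) ω
        + b * (Real.exp (κ * v) * R v ω - Real.exp (κ * u) * R u ω
        - Real.exp (κ * u) * (W v ω - W u ω)) : ℝ) * Complex.I) - 1) * Y u ω := by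
      intro ω
      have e : (L v ω : ℂ) * Complex.I = (a * (V v - V u) ω
        + b * Real.exp (κ * u) * (W v - W u) ω
        + b * (Real.exp (κ * v) * R v ω - Real.exp (κ * u) * R u ω
        - Real.exp (κ * u) * (W v ω - W u ω)) : ℝ) * Complex.I + L u ω * Complex.I := by
        rw [← add_mul, ← Complex.ofReal_add]
        simp only [hL, hN, Pi.sub_apply]; congr 2; ring
      simp only [hY]
      rw [e, Complex.exp_add]; ring
    rw [← integral_sub (iY v (hu.trans huv)) (iY u hu), integral_congr_ae (ae_of_all _ hYv)]
    refine h.trans ?_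
    simp only [abs_mul, integral_const_mul]
    have hs : √((v : ℝ) - u) ^ 3 = ((v : ℝ) - u) * √((v : ℝ) - u) := by
      rw [pow_succ, Real.sq_sqrt hsub]
    have hexp : |Real.exp (κ * u)| ≤ |Real.exp (κ * T)| := by
      rw [Real.abs_exp, Real.abs_exp]; have := u.2.2; gcongr
    have m3 := gaussianAbsMoment_nonneg 3
    rw [hs]
    calc _ ≤ |b| * (κ * Real.exp (κ * T) * gaussianAbsMoment 1
              * (((v : ℝ) - u) * √((v : ℝ) - u)))
            + 16 * (|a| ^ 3 + (|b| * |Real.exp (κ * T)|) ^ 3)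
              * (((v : ℝ) - u) * √((v : ℝ) - u) * gaussianAbsMoment 3) := by
          gcongr
      _ = _ := by simp only [hC, abs_mul]; ring
  have main := eq_exp_smul_of_norm_sub_add_smul_le
    (φ := fun s => ∫ ω, Y (Set.projIcc 0 T hT s) ω ∂P) (C := C) (a := (t₀ : ℝ)) (b := t₁) ht
    (by simp only [hq]; fun_prop) hQq
    (fun s _ => by
      refine (norm_integral_le_of_norm_le_const (ae_of_all _ (bY _))).trans ?_
      simp)
    (fun s hs t ht' hst => by
      have hs' : s ∈ Set.Icc 0 T := ⟨t₀.2.1.trans hs.1, hs.2.trans t₁.2.2⟩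
      have ht'' : t ∈ Set.Icc 0 T := ⟨t₀.2.1.trans ht'.1, ht'.2.trans t₁.2.2⟩
      rw [Set.projIcc_of_mem hT hs', Set.projIcc_of_mem hT ht'']
      exact step ⟨s, hs'⟩ ⟨t, ht''⟩ hs.1 hst)
  simp only [Set.projIcc_val] at main
  have h0 : ∀ ω, Y t₀ ω = Z ω := fun ω => by simp [hY, hL]
  simp only [h0] at main
  rw [main]
  congr 2
  simp only [hQ]; ring

end CharFun

/-! ### From characteristic functions to the conditional distribution -/

section Conditional

variable {Ω : Type*} {mΩ : MeasurableSpace Ω} {P : Measure Ω} [IsProbabilityMeasure P]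

/-- If `G` is Gaussian and independent of `X`, then `g X + G` is conditionally Gaussian given `X`,
with mean `g X`. -/
lemma condDistrib_add_ae_eq_gaussianReal {β : Type*} {mβ : MeasurableSpace β} {X : Ω → β}
    {G : Ω → ℝ} (hX : Measurable X) (hG : Measurable G) {v : NNReal}
    (h : P.map (fun ω => (X ω, G ω)) = (P.map X).prod (gaussianReal 0 v)) {g : β → ℝ}
    (hg : Measurable g) :
    ∀ᵐ ω ∂P, condDistrib (fun ω' => g (X ω') + G ω') X P (X ω) = gaussianReal (g (X ω)) v := by
  let κ : Kernel β ℝ := ⟨fun x => gaussianReal (g x) v, by fun_prop⟩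
  have hκ : ∀ x, κ x = gaussianReal (g x) v := fun _ => rfl
  have : IsMarkovKernel κ := ⟨fun x => by rw [hκ]; infer_instance⟩
  refine ae_of_ae_map hX.aemeasurable
    (condDistrib_ae_eq_of_measure_eq_compProd (κ := κ) X (by fun_prop) ?_)
  have hm : Measurable fun p : β × ℝ => (p.1, g p.1 + p.2) := by fun_prop
  have h1 : P.map (fun ω => (X ω, g (X ω) + G ω))
      = (P.map (fun ω => (X ω, G ω))).map (fun p => (p.1, g p.1 + p.2)) := by
    rw [Measure.map_map hm (by fun_prop)]; rfl
  rw [h1, h]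
  ext s hs
  rw [Measure.map_apply hm hs, Measure.prod_apply (hm hs), Measure.compProd_apply hs]
  refine lintegral_congr fun x => ?_
  have hx : κ x = (gaussianReal 0 v).map (g x + ·) := by
    rw [hκ, gaussianReal_map_const_add, zero_add]
  rw [hx, Measure.map_apply (by fun_prop) (measurable_prodMk_left hs)]
  rfl

/-- A characteristic function is bounded by `1`, so the variance in its Gaussian exponent cannot be
negative. -/
lemma nonneg_of_integral_cexp_eq_exp {G : Ω → ℝ} {w : ℝ}
    (h : ∫ ω, Complex.exp ((G ω : ℝ) * Complex.I) ∂P = (Real.exp (-w / 2) : ℂ)) : 0 ≤ w := by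
  have h1 : ‖∫ ω, Complex.exp ((G ω : ℝ) * Complex.I) ∂P‖ ≤ 1 := by
    refine (norm_integral_le_of_norm_le_const (C := 1) (ae_of_all _ fun ω => ?_)).trans (by simp)
    rw [Complex.norm_exp_ofReal_mul_I]
  rw [h, Complex.norm_real, Real.norm_of_nonneg (Real.exp_pos _).le, Real.exp_le_one_iff] at h1
  linarith

/-- If the joint characteristic function of `(X₁, X₂, G)` splits off a Gaussian factor in the last
variable, then `G` is Gaussian and independent of `(X₁, X₂)`. -/
lemma map_prodMk_eq_prod_gaussianReal {X₁ X₂ G : Ω → ℝ} (h₁ : Measurable X₁) (h₂ : Measurable X₂)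
    (hG : Measurable G) {v : NNReal}
    (h : ∀ c₁ c₂ γ : ℝ,
      ∫ ω, Complex.exp ((c₁ * X₁ ω + c₂ * X₂ ω + γ * G ω : ℝ) * Complex.I) ∂P
        = Real.exp (-(γ ^ 2 * v) / 2)
          • ∫ ω, Complex.exp ((c₁ * X₁ ω + c₂ * X₂ ω : ℝ) * Complex.I) ∂P) :
    P.map (fun ω => ((X₁ ω, X₂ ω), G ω))
      = (P.map (fun ω => (X₁ ω, X₂ ω))).prod (gaussianReal 0 v) := by
  have : IsProbabilityMeasure (P.map (fun ω => (X₁ ω, X₂ ω))) :=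
    Measure.isProbabilityMeasure_map (by fun_prop)
  have : IsProbabilityMeasure (P.map (fun ω => ((X₁ ω, X₂ ω), G ω))) :=
    Measure.isProbabilityMeasure_map (by fun_prop)
  rw [← charFunDual_eq_prod_iff]
  intro L
  obtain ⟨c₁, c₂, γ, hL⟩ : ∃ c₁ c₂ γ : ℝ, ∀ x y z : ℝ,
      L ((x, y), z) = c₁ * x + c₂ * y + γ * z := by
    refine ⟨L ((1, 0), 0), L ((0, 1), 0), L ((0, 0), 1), fun x y z => ?_⟩
    have e : (((x, y), z) : (ℝ × ℝ) × ℝ)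
        = x • ((1, 0), 0) + y • ((0, 1), 0) + z • ((0, 0), 1) := by simp
    rw [e, map_add, map_add, map_smul, map_smul, map_smul]
    simp only [smul_eq_mul]; ring
  have hg : charFunDual (gaussianReal 0 v) (L.comp (.inr ℝ (ℝ × ℝ) ℝ))
      = Real.exp (-(γ ^ 2 * v) / 2) := by
    have h1 := charFun_gaussianReal (μ := 0) (v := v) γ
    rw [charFun_apply_real] at h1
    rw [charFunDual_apply]
    calc _ = ∫ x : ℝ, Complex.exp (γ * x * Complex.I) ∂gaussianReal 0 v := by
          refine integral_congr_ae (ae_of_all _ fun x => ?_)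
          have h2 : L (0, x) = γ * x := (hL 0 0 x).trans (by simp)
          simp [h2]
      _ = _ := by rw [h1]; push_cast; congr 1; ring
  rw [hg, charFunDual_apply, charFunDual_apply, integral_map (by fun_prop) (by fun_prop),
    integral_map (by fun_prop) (by fun_prop)]
  simp only [ContinuousLinearMap.comp_apply, ContinuousLinearMap.inl_apply, hL, mul_zero, add_zero]
  rw [h, Complex.real_smul, mul_comm]

end Conditional

/-! ### The conditional distribution of the increment -/

theorem proposition4 {Ω : Type*} {mΩ : MeasurableSpace Ω} (P : Measure Ω) [IsProbabilityMeasure P]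
    (T κ ρ : ℝ) (hκ : 0 < κ)
    (F : Filtration (Set.Icc (0 : ℝ) T) mΩ)
    (WS Wr R : Set.Icc (0 : ℝ) T → Ω → ℝ)
    (hWS : IsWienerProcess F WS P) (hWr : IsWienerProcess F Wr P)
    (hcov : IsCrossVariation F WS Wr (fun t _ => ρ * (t : ℝ)) P)
    (hR : IsVasicekSolution F κ Wr R P)
    (t Δt : ℝ) (ht : 0 ≤ t) (hΔt : 0 < Δt) (htT : t + Δt ≤ T) :
    let t₀ : Set.Icc (0 : ℝ) T := ⟨t, ht, by linarith⟩
    let t₁ : Set.Icc (0 : ℝ) T := ⟨t + Δt, by linarith, htT⟩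
    ∃ v : NNReal,
      (v : ℝ) = Δt - 2 * (ρ ^ 2 / κ) *
        ((1 - Real.exp (-κ * Δt)) / (1 + Real.exp (-κ * Δt))) ∧
      ∀ᵐ ω ∂P,
        condDistrib (fun ω' => WS t₁ ω' - WS t₀ ω') (fun ω' => (R t₁ ω', R t₀ ω')) P
            (R t₁ ω, R t₀ ω) =
          gaussianReal
            (2 * ρ * ((1 - Real.exp (-κ * Δt)) / (1 - Real.exp (-2 * κ * Δt))) *
              (R t₁ ω - R t₀ ω * Real.exp (-κ * Δt))) v := by
  intro t₀ t₁
  have h01 : t₀ ≤ t₁ := show t ≤ t + Δt by linarith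
  have mS : ∀ s, Measurable (WS s) := hWS.measurable
  have mR : ∀ s, Measurable (R s) := fun s => (hR.adapted s).mono (F.le s) le_rfl
  set e₀ := Real.exp (κ * t₀) with he₀
  set r := Real.exp (-κ * Δt) with hr
  have pe₀ : 0 < e₀ := Real.exp_pos _
  have pr : 0 < r := Real.exp_pos _
  have r1 : r < 1 := by rw [hr, Real.exp_lt_one_iff]; nlinarith
  have he₁ : Real.exp (κ * t₁) = e₀ / r := by
    rw [he₀, hr, ← Real.exp_sub]; congr 1; simp only [t₀, t₁]; ring
  have hr2 : Real.exp (-2 * κ * Δt) = r ^ 2 := by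
    rw [hr, ← Real.exp_nat_mul]; congr 1; push_cast; ring
  set w := Δt - 2 * (ρ ^ 2 / κ) * ((1 - r) / (1 + r)) with hw
  -- The regression coefficient: the covariance of the two increments divided by the variance of the
  -- increment of `exp (κ t) R t`.
  set β := 2 * ρ * r / (e₀ * (1 + r)) with hβ
  set N : Ω → ℝ := fun ω => e₀ / r * R t₁ ω - e₀ * R t₀ ω with hN
  set G : Ω → ℝ := fun ω => WS t₁ ω - WS t₀ ω - β * N ω with hG
  have char : ∀ c₁ c₂ γ : ℝ,
      ∫ ω, Complex.exp ((c₁ * R t₁ ω + c₂ * R t₀ ω + γ * G ω : ℝ) * Complex.I) ∂P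
        = Real.exp (-(γ ^ 2 * w) / 2)
          • ∫ ω, Complex.exp ((c₁ * R t₁ ω + c₂ * R t₀ ω : ℝ) * Complex.I) ∂P := by
    intro c₁ c₂ γ
    set Z : Ω → ℂ := fun ω => Complex.exp (((c₁ * r + c₂) * R t₀ ω : ℝ) * Complex.I) with hZ
    have mZ : Measurable[F t₀] Z := by
      have hc : Measurable fun x : ℝ => Complex.exp (((c₁ * r + c₂) * x : ℝ) * Complex.I) := by
        fun_prop
      exact hc.comp (hR.adapted t₀)
    have hZ1 : ∀ ω, ‖Z ω‖ ≤ 1 := fun ω => (Complex.norm_exp_ofReal_mul_I _).le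
    have key := integral_cexp_increments_mul hκ hWS hWr hcov hR h01 mZ hZ1
    simp only [he₁, ← he₀] at key
    -- The coefficient `c₁ * r / e₀` rewrites `c₁ R t₁` through the increment of `exp (κ t) R t`; the
    -- remaining multiple of `R t₀` is absorbed by `Z`.
    have k1 := key γ (c₁ * r / e₀ - γ * β)
    have k2 := key 0 (c₁ * r / e₀)
    have a1 : ∀ ω, Complex.exp ((γ * (WS t₁ ω - WS t₀ ω)
        + (c₁ * r / e₀ - γ * β) * (e₀ / r * R t₁ ω - e₀ * R t₀ ω) : ℝ) * Complex.I) * Z ω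
        = Complex.exp ((c₁ * R t₁ ω + c₂ * R t₀ ω + γ * G ω : ℝ) * Complex.I) := by
      intro ω
      simp only [hZ]
      rw [← Complex.exp_add, ← add_mul, ← Complex.ofReal_add]
      congr 3
      simp only [hG, hN]; field_simp; ring
    have a2 : ∀ ω, Complex.exp ((0 * (WS t₁ ω - WS t₀ ω)
        + c₁ * r / e₀ * (e₀ / r * R t₁ ω - e₀ * R t₀ ω) : ℝ) * Complex.I) * Z ω
        = Complex.exp ((c₁ * R t₁ ω + c₂ * R t₀ ω : ℝ) * Complex.I) := by
      intro ω
      simp only [hZ]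
      rw [← Complex.exp_add, ← add_mul, ← Complex.ofReal_add]
      congr 3
      field_simp; ring
    simp only [a1] at k1
    simp only [a2] at k2
    -- By the choice of `β`, the mixed terms in the exponent cancel.
    rw [k1, k2, ← mul_smul, ← Real.exp_add]
    congr 2
    have hd : (t₁ : ℝ) - t₀ = Δt := by simp [t₀, t₁]
    rw [hd, hw, hβ]
    have : 1 + r ≠ 0 := by positivity
    field_simp
    ring
  have hw0 : 0 ≤ w := by
    have h := char 0 0 1
    simp only [zero_mul, zero_add, one_mul, one_pow, Complex.ofReal_zero, Complex.exp_zero,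
      integral_const, probReal_univ, one_smul] at h
    exact nonneg_of_integral_cexp_eq_exp (G := G) (by rw [h, Complex.real_smul, mul_one])
  refine ⟨⟨w, hw0⟩, rfl, ?_⟩
  have hcond := condDistrib_add_ae_eq_gaussianReal (P := P)
    (X := fun ω => (R t₁ ω, R t₀ ω)) (G := G) (by fun_prop) (by fun_prop) (v := ⟨w, hw0⟩)
    (map_prodMk_eq_prod_gaussianReal (mR t₁) (mR t₀) (by fun_prop) char)
    (g := fun x => β * (e₀ / r * x.1 - e₀ * x.2)) (by fun_prop)
  have hsum : (fun ω => β * (e₀ / r * R t₁ ω - e₀ * R t₀ ω) + G ω)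
      = fun ω => WS t₁ ω - WS t₀ ω := by
    funext ω; simp only [hG, hN]; ring
  simp only [hsum] at hcond
  filter_upwards [hcond] with ω hω
  rw [hω, hr2]
  congr 1
  have h1 : 1 - r ^ 2 ≠ 0 := by nlinarith
  have h2 : 1 + r ≠ 0 := by positivity
  have h3 : (1 - r) / (1 - r ^ 2) = 1 / (1 + r) := by
    rw [div_eq_div_iff h1 h2]; ring
  rw [h3, hβ]
  field_simp
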